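/- Let $X=\{z\in\mathbb C: |\operatorname{Re} z|+|\operatorname{Im} z|\le 1\}$ be the closed diamond with corners $\pm1,\pm i$, and let $t:\mathbb C\to\mathbb C$ be given (with $\arg z\in(-\pi,\pi]$) by $t(0)=0$ and, for $z\neq0$, $$t(z)=\begin{cases} z-1 & \text{if } -\pi/4\le\arg z<\pi/4,\\ z-i & \text{if } \pi/4\le\arg z<3\pi/4,\\ z+1 & \text{if } \arg z\ge 3\pi/4 \text{ or } \arg z<-3\pi/4,\\ z+i & \text{if } -3\pi/4\le \arg z<-\pi/4.\end{cases}$$ The diamond algorithm is given by the function $\lfloor z\rceil=0$ for $z\in X$ and $\lfloor z\rceil=z-t^{n(z)}(z)$ for $z\notin X$, where $n(z)$ is the least $n\ge1$ with $t^{n}(z)\in X$. Its fundamental set is $K=\overline{\{z-\lfloor z\rceil : z\in\mathbb C\setminus\{0\}\}}$ and its Gauss map is $G(z)=-1/z-\lfloor -1/z\rceil$ for $z\ne0$, $G(0)=0$. Let $$\begin{aligned}K_1&=\{z\in X: |z-\tfrac{-1-i}2|\le\tfrac1{\sqrt2},\ |z-\tfrac{-1+i}2|\le\tfrac1{\sqrt2}\},\\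 K_2&=\{z\in X: |z-\tfrac{-1-i}2|\ge\tfrac1{\sqrt2},\ 0\le\operatorname{Im}z\le-\operatorname{Re}z\},\\ K_3&=\{z\in X: |z-\tfrac{1+i}2|\ge\tfrac1{\sqrt2},\ -\operatorname{Im}z\le\operatorname{Re}z\le0\},\\ K_i&=-i\,K_{i-3}\quad(4\le i\le12,\ \text{where the factor } -i \text{ is minus the imaginary unit}).\end{aligned}$$ **Proposition.** The number $n(z)$ exists for every $z\in\mathbb C\setminus X$; the function $\lfloor\cdot\rceil$ is a choice function, that is, for every $z\neq0$ one has $\lfloor z\rceil\in\mathbb Z[i]$ and $|z-\lfloor z\rceil|\le1$; and its fundamental set is $K=X$. The diamond algorithm satisfies the finite building property with $\mathcal P=\{K_1,\dots,K_{12}\}$. That is, $K_1,\dots,K_{12}$ are distinct nonempty closed sets whose boundaries have Lebesgue measure zero, their union is $K$, their interiors are pairwise disjoint, and for each $i$ the image $G(K_i)$ is equal, up to a set of Lebesgue measure zero, to a union of some of the sets $K_1,\dots,K_{12}$. -/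

import Mathlib

open MeasureTheory

noncomputable section

/-- A choice function `ℂ ∖ {0} → ℤ[i]`, as a function on `ℂ` whose value at `0` is irrelevant:
its values are Gaussian integers and `|z - c z| ≤ 1`. -/
def IsChoiceFunction (c : ℂ → ℂ) : Prop :=
  ∀ z : ℂ, z ≠ 0 → (∃ m n : ℤ, c z = (m : ℂ) + (n : ℂ) * Complex.I) ∧ ‖z - c z‖ ≤ 1

/-- The fundamental set of a choice function: the closure of the set of all `z - c z`. -/
def fundamentalSet (c : ℂ → ℂ) : Set ℂ :=
  closure {w : ℂ | ∃ z : ℂ, z ≠ 0 ∧ w = z - c z}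

/-- The Gauss map of a choice function. -/
def gaussMap (c : ℂ → ℂ) (z : ℂ) : ℂ :=
  open Classical in if z = 0 then 0 else -1 / z - c (-1 / z)

/-- `P 0, …, P (N - 1)` is a partition of `K` in the sense used for Markov partitions: the
pieces are nonempty and distinct, they cover `K`, and their interiors are pairwise disjoint. -/
structure IsInteriorPartition {N : ℕ} (P : Fin N → Set ℂ) (K : Set ℂ) : Prop where
  nonempty : ∀ i, (P i).Nonempty
  injective : Function.Injective P
  iUnion_eq : ⋃ i, P i = K
  disjoint_interior : ∀ i j, i ≠ j → Disjoint (interior (P i)) (interior (P j))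

/-- `A` is equal, up to a set of Lebesgue measure zero, to a union of some of the sets `P i`. -/
def IsBuildable {N : ℕ} (P : Fin N → Set ℂ) (A : Set ℂ) : Prop :=
  ∃ J : Set (Fin N), A =ᵐ[volume] ⋃ j ∈ J, P j

/-- The algorithm given by the choice function `c` satisfies the finite building property with
the partition `P 0, …, P (N - 1)` of its fundamental set. The pieces are closed sets whose
boundaries have measure zero, as is required of a collection from which sets are built. -/
structure SatisfiesFiniteBuildingWith (c : ℂ → ℂ) {N : ℕ} (P : Fin N → Set ℂ) : Prop where
  one_lt : 1 < N
  partition : IsInteriorPartition P (fundamentalSet c)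
  isClosed : ∀ i, IsClosed (P i)
  volume_frontier : ∀ i, volume (frontier (P i)) = 0
  buildable : ∀ i, IsBuildable P (gaussMap c '' P i)

/-- The map `t` which moves `z ≠ 0` by a unit step towards the origin; the direction depends on
the quarter of the plane that contains `z`. The last case is `-3π/4 ≤ arg z < -π/4`. -/
def unitStep (z : ℂ) : ℂ :=
  open Classical in
  if z = 0 then 0
  else if -Real.pi / 4 ≤ z.arg ∧ z.arg < Real.pi / 4 then z - 1
  else if Real.pi / 4 ≤ z.arg ∧ z.arg < 3 * Real.pi / 4 then z - Complex.I
  else if 3 * Real.pi / 4 ≤ z.arg ∨ z.arg < -(3 * Real.pi / 4) then z + 1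
  else z + Complex.I

/-- The first time `n ≥ 1` at which the orbit of `z` under `unitStep` is in `X`. -/
def hittingNumber (X : Set ℂ) (z : ℂ) : ℕ :=
  sInf {n : ℕ | 1 ≤ n ∧ unitStep^[n] z ∈ X}

/-- The choice function constructed from a set `X`. -/
def choiceOfSet (X : Set ℂ) (z : ℂ) : ℂ :=
  open Classical in if z ∈ X then 0 else z - unitStep^[hittingNumber X z] z

/-- The closed diamond with corners `±1` and `±i`. -/
def diamond : Set ℂ := {z : ℂ | |z.re| + |z.im| ≤ 1}

/-- The choice function of the diamond algorithm. -/
def diamondChoice : ℂ → ℂ := choiceOfSet diamond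

/-- The sets `K₁, …, K₁₂` are `diamondPiece 1, …, diamondPiece 12`, where `K₁, K₂, K₃` are given
explicitly and `Kᵢ = -i · Kᵢ₋₃` for `4 ≤ i ≤ 12`. Other indices are not used. -/
def diamondPiece : ℕ → Set ℂ
  | 0 => ∅
  | 1 => {z : ℂ | z ∈ diamond ∧ ‖z - (-1 - Complex.I) / 2‖ ≤ 1 / Real.sqrt 2 ∧
      ‖z - (-1 + Complex.I) / 2‖ ≤ 1 / Real.sqrt 2}
  | 2 => {z : ℂ | z ∈ diamond ∧ 1 / Real.sqrt 2 ≤ ‖z - (-1 - Complex.I) / 2‖ ∧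
      0 ≤ z.im ∧ z.im ≤ -z.re}
  | 3 => {z : ℂ | z ∈ diamond ∧ 1 / Real.sqrt 2 ≤ ‖z - (1 + Complex.I) / 2‖ ∧
      -z.im ≤ z.re ∧ z.re ≤ 0}
  | n + 4 => (fun z : ℂ => -Complex.I * z) '' diamondPiece (n + 1)

/-- The partition `{K₁, …, K₁₂}` as a family indexed by `Fin 12`. -/
def diamondPartition (i : Fin 12) : Set ℂ := diamondPiece ((i : ℕ) + 1)

end

/-! ### The step map -/

/-! Work in the coordinates s = re + im and d = re - im. The diamond X is the square |s| ≤ 1, |d| ≤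
1, and away from the lines s = 0 and d = 0 one step replaces s by s - sgn s and d by d - sgn d
(`unitStep_cases`). Outside X a step enters X or lowers the ℓ¹ norm by 1, so every orbit enters X;
the choice is 0 on X, and this gives K = X.

For the images, put w = -1/z. The circles bounding the pieces pass through 0, so they become lines:
for z in K₁ the point w has s ≥ 1 and d ≥ 1, while for z in K₂ or K₃ it lies in the strip |d| ≤ 1
with s ≥ 0. The independent motion of s and d then locates the entry point p of the orbit of w. From
the strip, only s can exceed 1, so p has s > 0 (`landing_of_strip`); from K₁, a coordinate that
exceeds 1 just before entry is positive at p (`landing_of_one_le`). Conversely, every such p is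
reached from a translate of p by 2, 1 + i, 2 + i or 1 + 2i. So G(K₁) is X without the quarter s < 0,
d < 0, which is K₁ ∪ K₂ ∪ K₁₂, and G(K₂) = G(K₃) is the half s > 0, which is K₃ ∪ … ∪ K₈. Both hold
off the null set of diagonals on which s or d is an integer (`OffGrid`), a condition unaffected by
Gaussian translations.

The step commutes with multiplication by i, hence G(z) = i G(iz), and the other nine pieces follow
by rotation (`fin_twelve_induction`). The topological claims hold because each piece is a closed
convex set minus an open convex set, and points common to two pieces lie on finitely many lines and
circles. -/

theorem mem_diamond_iff {z : ℂ} :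
    z ∈ diamond ↔ |z.re + z.im| ≤ 1 ∧ |z.re - z.im| ≤ 1 := by
  simp only [diamond, Set.mem_ofPred_eq]
  constructor
  · intro h
    exact ⟨(abs_add_le _ _).trans h, (abs_sub _ _).trans h⟩
  · rintro ⟨h₁, h₂⟩
    rw [abs_le] at h₁ h₂
    cases abs_cases z.re <;> cases abs_cases z.im <;> linarith

/-- The four branches of `unitStep`, in terms of the signs of `re + im` and `re - im`. -/
theorem unitStep_cases {z : ℂ} (hz : z ≠ 0) :
    (0 ≤ z.re + z.im ∧ 0 < z.re - z.im ∧ unitStep z = z - 1) ∨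
    (0 < z.re + z.im ∧ z.re - z.im ≤ 0 ∧ unitStep z = z - Complex.I) ∨
    (z.re + z.im ≤ 0 ∧ z.re - z.im < 0 ∧ unitStep z = z + 1) ∨
    (z.re + z.im < 0 ∧ 0 ≤ z.re - z.im ∧ unitStep z = z + Complex.I) := by
  have hr : 0 < ‖z‖ := norm_pos_iff.mpr hz
  have hpi := Real.pi_pos
  obtain ⟨hl, hu⟩ := Complex.arg_mem_Ioc z
  -- Turning the plane by π/4 takes the four sectors to quadrants, so the signs of sine and cosine
  -- at arg + π/4 decide the branch.
  obtain ⟨k, hk, hs, hd⟩ : ∃ k : ℝ, 0 < k ∧ z.re + z.im = k * Real.sin (z.arg + Real.pi / 4) ∧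
      z.re - z.im = k * Real.cos (z.arg + Real.pi / 4) := by
    refine ⟨‖z‖ * √2, by positivity, ?_, ?_⟩
    · rw [Real.sin_add, Real.cos_pi_div_four, Real.sin_pi_div_four]
      conv_lhs => rw [← Complex.norm_mul_cos_arg z, ← Complex.norm_mul_sin_arg z]
      linear_combination (-(‖z‖ * (Real.sin z.arg + Real.cos z.arg) / 2)) *
        Real.mul_self_sqrt (zero_le_two (α := ℝ))
    · rw [Real.cos_add, Real.cos_pi_div_four, Real.sin_pi_div_four]
      conv_lhs => rw [← Complex.norm_mul_cos_arg z, ← Complex.norm_mul_sin_arg z]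
      linear_combination (-(‖z‖ * (Real.cos z.arg - Real.sin z.arg) / 2)) *
        Real.mul_self_sqrt (zero_le_two (α := ℝ))
  rw [hs, hd]
  have hn : ∀ x, k * x ≤ 0 ↔ x ≤ 0 := fun x => by
    rw [← not_lt, mul_pos_iff_of_pos_left hk, not_lt]
  have hn' : ∀ x, k * x < 0 ↔ x < 0 := fun x => by
    rw [← not_le, mul_nonneg_iff_of_pos_left hk, not_le]
  simp only [mul_nonneg_iff_of_pos_left hk, mul_pos_iff_of_pos_left hk, hn, hn']
  unfold unitStep
  rw [if_neg hz]
  split_ifs with h₁ h₂ h₃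
  · exact .inl ⟨Real.sin_nonneg_of_nonneg_of_le_pi (by linarith) (by linarith),
      Real.cos_pos_of_mem_Ioo ⟨by linarith, by linarith⟩, rfl⟩
  · exact .inr <| .inl ⟨Real.sin_pos_of_pos_of_lt_pi (by linarith) (by linarith),
      Real.cos_nonpos_of_pi_div_two_le_of_le (by linarith) (by linarith), rfl⟩
  · refine .inr <| .inr <| .inl ?_
    rcases h₃ with h | h
    · have e₁ := Real.sin_sub_pi (z.arg + Real.pi / 4)
      have e₂ := Real.cos_sub_pi (z.arg + Real.pi / 4)
      have i₁ := Real.sin_nonneg_of_nonneg_of_le_pi (x := z.arg + Real.pi / 4 - Real.pi)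
        (by linarith) (by linarith)
      have i₂ := Real.cos_pos_of_mem_Ioo (x := z.arg + Real.pi / 4 - Real.pi)
        ⟨by linarith, by linarith⟩
      exact ⟨by linarith, by linarith, rfl⟩
    · have e₂ := Real.cos_add_pi (z.arg + Real.pi / 4)
      have i₂ := Real.cos_pos_of_mem_Ioo (x := z.arg + Real.pi / 4 + Real.pi)
        ⟨by linarith, by linarith⟩
      exact ⟨(Real.sin_neg_of_neg_of_neg_pi_lt (by linarith) (by linarith)).le,
        by linarith, rfl⟩
  · have h₄ : -(3 * Real.pi / 4) ≤ z.arg ∧ z.arg < -Real.pi / 4 := by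
      by_contra! h
      refine h₃ ?_
      by_contra! h'
      have := h h'.2
      exact h₂ ⟨by by_contra! h₅; exact h₁ ⟨this, h₅⟩, h'.1⟩
    exact .inr <| .inr <| .inr ⟨Real.sin_neg_of_neg_of_neg_pi_lt (by linarith) (by linarith),
      Real.cos_nonneg_of_mem_Icc ⟨by linarith, by linarith⟩, rfl⟩

theorem zero_mem_diamond : (0 : ℂ) ∈ diamond := by simp [diamond]

theorem ne_zero_of_notMem_diamond {z : ℂ} (hz : z ∉ diamond) : z ≠ 0 := by
  rintro rfl
  exact hz zero_mem_diamond

/-- Outside the diamond, a step reaches the diamond or lowers the `ℓ¹` norm by `1`. -/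
theorem unitStep_mem_diamond_or {z : ℂ} (hz : z ∉ diamond) :
    unitStep z ∈ diamond ∨
      |(unitStep z).re| + |(unitStep z).im| ≤ |z.re| + |z.im| - 1 := by
  have h := unitStep_cases (ne_zero_of_notMem_diamond hz)
  simp only [diamond, Set.mem_ofPred_eq, not_le] at hz ⊢
  rcases h with ⟨h₁, h₂, h⟩ | ⟨h₁, h₂, h⟩ | ⟨h₁, h₂, h⟩ | ⟨h₁, h₂, h⟩ <;> rw [h] <;>
    simp only [Complex.sub_re, Complex.sub_im, Complex.add_re, Complex.add_im, Complex.one_re,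
      Complex.one_im, Complex.I_re, Complex.I_im, sub_zero, add_zero]
  · rcases le_total 1 z.re with h' | h'
    · right
      cases abs_cases z.re <;> cases abs_cases (z.re - 1) <;> linarith
    · left
      cases abs_cases z.im <;> cases abs_cases (z.re - 1) <;> linarith
  · rcases le_total 1 z.im with h' | h'
    · right
      cases abs_cases z.im <;> cases abs_cases (z.im - 1) <;> linarith
    · left
      cases abs_cases z.re <;> cases abs_cases (z.im - 1) <;> linarith
  · rcases le_total z.re (-1) with h' | h'
    · right
      cases abs_cases z.re <;> cases abs_cases (z.re + 1) <;> linarith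
    · left
      cases abs_cases z.im <;> cases abs_cases (z.re + 1) <;> linarith
  · rcases le_total z.im (-1) with h' | h'
    · right
      cases abs_cases z.im <;> cases abs_cases (z.im + 1) <;> linarith
    · left
      cases abs_cases z.re <;> cases abs_cases (z.im + 1) <;> linarith

theorem exists_iterate_unitStep_mem_diamond {z : ℂ} (hz : z ∉ diamond) :
    ∃ n : ℕ, 1 ≤ n ∧ unitStep^[n] z ∈ diamond := by
  obtain ⟨k, hk⟩ := exists_nat_ge (|z.re| + |z.im|)
  induction k generalizing z with
  | zero =>
    refine absurd ?_ hz
    simp only [diamond, Set.mem_ofPred_eq]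
    push_cast at hk
    linarith
  | succ k ih =>
    by_cases h : unitStep z ∈ diamond
    · exact ⟨1, le_rfl, h⟩
    · obtain ⟨n, -, hn⟩ := ih h (by
        have := (unitStep_mem_diamond_or hz).resolve_left h
        push_cast at hk
        linarith)
      exact ⟨n + 1, by omega, hn⟩

/-- The point at which the orbit of `z` under `unitStep` enters the diamond. -/
noncomputable def landing (z : ℂ) : ℂ := unitStep^[hittingNumber diamond z] z

theorem sub_diamondChoice {z : ℂ} (hz : z ∉ diamond) : z - diamondChoice z = landing z := by
  simp [diamondChoice, choiceOfSet, hz, landing]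

theorem diamondChoice_of_mem {z : ℂ} (hz : z ∈ diamond) : diamondChoice z = 0 := by
  simp [diamondChoice, choiceOfSet, hz]

theorem landing_of_step_mem {z : ℂ} (h : unitStep z ∈ diamond) : landing z = unitStep z := by
  have : hittingNumber diamond z = 1 :=
    le_antisymm (Nat.sInf_le ⟨le_rfl, h⟩)
      (Nat.sInf_mem (s := {n | 1 ≤ n ∧ unitStep^[n] z ∈ diamond}) ⟨1, le_rfl, h⟩).1
  rw [landing, this, Function.iterate_one]

theorem landing_of_step_notMem {z : ℂ} (h : unitStep z ∉ diamond) :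
    landing z = landing (unitStep z) := by
  have ne₁ : {n | 1 ≤ n ∧ unitStep^[n] (unitStep z) ∈ diamond}.Nonempty :=
    exists_iterate_unitStep_mem_diamond h
  have mem₁ := Nat.sInf_mem ne₁
  have ne₀ : {n | 1 ≤ n ∧ unitStep^[n] z ∈ diamond}.Nonempty :=
    ⟨_, Nat.le_add_left 1 _, mem₁.2⟩
  have mem₀ := Nat.sInf_mem ne₀
  have : hittingNumber diamond z = hittingNumber diamond (unitStep z) + 1 := by
    refine le_antisymm (Nat.sInf_le ⟨Nat.le_add_left 1 _, mem₁.2⟩) ?_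
    obtain ⟨m, hm⟩ : ∃ m, hittingNumber diamond z = m + 1 :=
      ⟨hittingNumber diamond z - 1, (Nat.sub_add_cancel mem₀.1).symm⟩
    have hm' : unitStep^[m] (unitStep z) ∈ diamond := by
      have := mem₀.2
      change unitStep^[hittingNumber diamond z] z ∈ diamond at this
      rwa [hm] at this
    rw [hm]
    refine Nat.succ_le_succ (Nat.sInf_le ⟨?_, hm'⟩)
    -- Hitting times start at 1, so m = 0 has to be excluded: it would put `unitStep z` itself in
    -- the diamond.
    rcases m with _ | m
    · exact absurd hm' h
    · omega
  rw [landing, this, Function.iterate_succ_apply, landing]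

/-- Induction along the orbit of a point outside the diamond, up to its entry. -/
theorem landing_induction {Q : ℂ → Prop} {R : ℂ → Prop}
    (step : ∀ z, z ∉ diamond → Q z → unitStep z ∉ diamond → Q (unitStep z))
    (last : ∀ z, z ∉ diamond → Q z → unitStep z ∈ diamond → R (unitStep z))
    {z : ℂ} (hz : z ∉ diamond) (hQ : Q z) : R (landing z) := by
  obtain ⟨n, -, hn⟩ := exists_iterate_unitStep_mem_diamond hz
  induction n generalizing z with
  | zero => exact absurd hn hz
  | succ n ih =>
    by_cases h : unitStep z ∈ diamond
    · rw [landing_of_step_mem h]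
      exact last z hz hQ h
    · rw [landing_of_step_notMem h]
      exact ih h (step z hz hQ h) hn

theorem landing_mem_diamond {z : ℂ} (hz : z ∉ diamond) : landing z ∈ diamond :=
  landing_induction (Q := fun _ => True) (R := fun z => z ∈ diamond)
    (fun _ _ _ _ => trivial) (fun _ _ _ h => h) hz trivial

/-- `z` is a Gaussian integer. -/
def IsGaussian (z : ℂ) : Prop := ∃ m n : ℤ, z = (m : ℂ) + (n : ℂ) * Complex.I

theorem isGaussian_sub_unitStep {w z : ℂ} (h : IsGaussian (w - z)) :
    IsGaussian (w - unitStep z) := by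
  obtain ⟨m, n, h⟩ := h
  by_cases hz : z = 0
  · exact ⟨m, n, by rw [← h]; simp [unitStep, hz]⟩
  rcases unitStep_cases hz with ⟨-, -, e⟩ | ⟨-, -, e⟩ | ⟨-, -, e⟩ | ⟨-, -, e⟩
  · exact ⟨m + 1, n, by rw [e]; push_cast; linear_combination h⟩
  · exact ⟨m, n + 1, by rw [e]; push_cast; linear_combination h⟩
  · exact ⟨m - 1, n, by rw [e]; push_cast; linear_combination h⟩
  · exact ⟨m, n - 1, by rw [e]; push_cast; linear_combination h⟩

theorem isGaussian_diamondChoice (z : ℂ) : IsGaussian (diamondChoice z) := by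
  by_cases hz : z ∈ diamond
  · exact ⟨0, 0, by simp [diamondChoice_of_mem hz]⟩
  · rw [← sub_sub_cancel z (diamondChoice z), sub_diamondChoice hz]
    exact landing_induction (Q := fun y => IsGaussian (z - y))
      (R := fun y => IsGaussian (z - y)) (fun _ _ h _ => isGaussian_sub_unitStep h)
      (fun _ _ h _ => isGaussian_sub_unitStep h) hz ⟨0, 0, by simp⟩

theorem norm_le_one_of_mem_diamond {z : ℂ} (hz : z ∈ diamond) : ‖z‖ ≤ 1 :=
  (Complex.norm_le_abs_re_add_abs_im z).trans hz

theorem sub_diamondChoice_mem_diamond (z : ℂ) : z - diamondChoice z ∈ diamond := by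
  by_cases hz : z ∈ diamond
  · rwa [diamondChoice_of_mem hz, sub_zero]
  · rw [sub_diamondChoice hz]
    exact landing_mem_diamond hz

theorem isChoiceFunction_diamondChoice : IsChoiceFunction diamondChoice := fun z _ =>
  ⟨isGaussian_diamondChoice z, norm_le_one_of_mem_diamond (sub_diamondChoice_mem_diamond z)⟩

theorem isClosed_diamond : IsClosed diamond :=
  isClosed_le (by fun_prop) continuous_const

theorem fundamentalSet_diamondChoice : fundamentalSet diamondChoice = diamond := by
  refine Set.Subset.antisymm (closure_minimal ?_ isClosed_diamond) fun z hz => ?_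
  · rintro w ⟨z, -, rfl⟩
    exact sub_diamondChoice_mem_diamond z
  · have key : ∀ z ∈ diamond, z ≠ 0 → z ∈ {w : ℂ | ∃ z : ℂ, z ≠ 0 ∧ w = z - diamondChoice z} :=
      fun z hz h0 => ⟨z, h0, by rw [diamondChoice_of_mem hz, sub_zero]⟩
    -- The set of differences excludes the input 0, so the point 0 is obtained as a limit of the
    -- points 1 / (n + 1).
    by_cases h0 : z = 0
    · subst h0
      rw [fundamentalSet]
      refine mem_closure_of_tendsto (f := fun n : ℕ => ((1 / ((n : ℝ) + 1) : ℝ) : ℂ))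
        (b := Filter.atTop) ?_ (Filter.Eventually.of_forall fun n => key _ ?_ ?_)
      · have := (Complex.continuous_ofReal.tendsto 0).comp
          (tendsto_one_div_add_atTop_nhds_zero_nat (𝕜 := ℝ))
        simpa [Function.comp_def] using this
      · have h : (0 : ℝ) < (n : ℝ) + 1 := by positivity
        simp only [diamond, Set.mem_ofPred_eq, Complex.ofReal_re, Complex.ofReal_im, abs_zero,
          add_zero]
        rw [abs_of_pos (by positivity), div_le_one h]
        simp
      · have h : (0 : ℝ) < 1 / ((n : ℝ) + 1) := by positivity
        exact_mod_cast h.ne'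
    · exact subset_closure (key z hz h0)

/-! ### The pieces -/

theorem mem_diamondPiece_add_four {n : ℕ} {z : ℂ} :
    z ∈ diamondPiece (n + 4) ↔ Complex.I * z ∈ diamondPiece (n + 1) := by
  rw [diamondPiece, Set.mem_image]
  constructor
  · rintro ⟨y, hy, rfl⟩
    rwa [← mul_assoc, mul_neg, Complex.I_mul_I, neg_neg, one_mul]
  · intro h
    exact ⟨_, h, by rw [← mul_assoc, neg_mul, Complex.I_mul_I, neg_neg, one_mul]⟩

theorem mem_diamondPartition_add_three {i : Fin 12} {z : ℂ} :
    z ∈ diamondPartition (i + 3) ↔ Complex.I * z ∈ diamondPartition i := by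
  -- Addition in `Fin 12` wraps around, in agreement with i⁴ = 1.
  have wrap : ∀ n : ℕ, z ∈ diamondPiece (n + 1) ↔ Complex.I * z ∈ diamondPiece (n + 10) := by
    intro n
    rw [mem_diamondPiece_add_four (n := n + 6), mem_diamondPiece_add_four (n := n + 3),
      mem_diamondPiece_add_four (n := n)]
    have : Complex.I * (Complex.I * (Complex.I * (Complex.I * z))) = z := by
      linear_combination (Complex.I ^ 2 - 1) * z * Complex.I_sq
    rw [this]
  fin_cases i
  exacts [mem_diamondPiece_add_four, mem_diamondPiece_add_four, mem_diamondPiece_add_four,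
    mem_diamondPiece_add_four, mem_diamondPiece_add_four, mem_diamondPiece_add_four,
    mem_diamondPiece_add_four, mem_diamondPiece_add_four, mem_diamondPiece_add_four,
    wrap 0, wrap 1, wrap 2]

/-- A property of the pieces which is invariant under rotation holds for all of them if it holds
for the first three. -/
theorem fin_twelve_induction {C : Fin 12 → Prop} (h0 : C 0) (h1 : C 1) (h2 : C 2)
    (step : ∀ i, C i → C (i + 3)) (i : Fin 12) : C i := by
  have h3 := step _ h0
  have h4 := step _ h1
  have h5 := step _ h2
  have h6 := step _ h3
  have h7 := step _ h4
  have h8 := step _ h5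
  have h9 := step _ h6
  have h10 := step _ h7
  have h11 := step _ h8
  fin_cases i <;> assumption

/-- Since |c|² = 1/2 is the squared radius, the constant term cancels: the circle passes through 0,
which is why inversion makes it a line. -/
theorem norm_sub_le_inv_sqrt_two_iff {a b : ℝ} (ha : a ^ 2 = 1) (hb : b ^ 2 = 1) {z c : ℂ}
    (hc : c = (a + b * Complex.I) / 2) :
    ‖z - c‖ ≤ 1 / √2 ↔ z.re ^ 2 + z.im ^ 2 - a * z.re - b * z.im ≤ 0 := by
  have hre : c.re = a / 2 := by rw [hc]; simp
  have him : c.im = b / 2 := by rw [hc]; simp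
  rw [← sq_le_sq₀ (norm_nonneg _) (by positivity), div_pow, Real.sq_sqrt zero_le_two,
    ← Complex.normSq_eq_norm_sq, Complex.normSq_apply, Complex.sub_re, Complex.sub_im, hre, him]
  constructor <;> intro h <;> nlinarith

theorem inv_sqrt_two_le_norm_sub_iff {a b : ℝ} (ha : a ^ 2 = 1) (hb : b ^ 2 = 1) {z c : ℂ}
    (hc : c = (a + b * Complex.I) / 2) :
    1 / √2 ≤ ‖z - c‖ ↔ 0 ≤ z.re ^ 2 + z.im ^ 2 - a * z.re - b * z.im := by
  have hre : c.re = a / 2 := by rw [hc]; simp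
  have him : c.im = b / 2 := by rw [hc]; simp
  rw [← sq_le_sq₀ (by positivity) (norm_nonneg _), div_pow, Real.sq_sqrt zero_le_two,
    ← Complex.normSq_eq_norm_sq, Complex.normSq_apply, Complex.sub_re, Complex.sub_im, hre, him]
  constructor <;> intro h <;> nlinarith

theorem mem_diamondPartition_zero {z : ℂ} :
    z ∈ diamondPartition 0 ↔ z ∈ diamond ∧ z.re ^ 2 + z.im ^ 2 + z.re + z.im ≤ 0 ∧
      z.re ^ 2 + z.im ^ 2 + z.re - z.im ≤ 0 := by
  change z ∈ diamond ∧ _ ∧ _ ↔ _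
  rw [norm_sub_le_inv_sqrt_two_iff (a := -1) (b := -1) (by norm_num) (by norm_num)
      (by push_cast; ring),
    norm_sub_le_inv_sqrt_two_iff (a := -1) (b := 1) (by norm_num) (by norm_num)
      (by push_cast; ring)]
  ring_nf

theorem mem_diamondPartition_one {z : ℂ} :
    z ∈ diamondPartition 1 ↔ z ∈ diamond ∧ 0 ≤ z.re ^ 2 + z.im ^ 2 + z.re + z.im ∧
      0 ≤ z.im ∧ z.im ≤ -z.re := by
  change z ∈ diamond ∧ _ ∧ _ ↔ _
  rw [inv_sqrt_two_le_norm_sub_iff (a := -1) (b := -1) (by norm_num) (by norm_num)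
      (by push_cast; ring)]
  ring_nf

theorem mem_diamondPartition_two {z : ℂ} :
    z ∈ diamondPartition 2 ↔ z ∈ diamond ∧ 0 ≤ z.re ^ 2 + z.im ^ 2 - z.re - z.im ∧
      -z.im ≤ z.re ∧ z.re ≤ 0 := by
  change z ∈ diamond ∧ _ ∧ _ ↔ _
  rw [inv_sqrt_two_le_norm_sub_iff (a := 1) (b := 1) (by norm_num) (by norm_num)
      (by push_cast; ring)]
  ring_nf

theorem I_mul_mem_diamond_iff {z : ℂ} : Complex.I * z ∈ diamond ↔ z ∈ diamond := by
  simp [diamond, add_comm]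

theorem diamondPartition_subset_diamond (i : Fin 12) : diamondPartition i ⊆ diamond := by
  refine fin_twelve_induction (C := fun i => diamondPartition i ⊆ diamond)
    (fun z hz => (mem_diamondPartition_zero.1 hz).1)
    (fun z hz => (mem_diamondPartition_one.1 hz).1)
    (fun z hz => (mem_diamondPartition_two.1 hz).1) (fun i h z hz => ?_) i
  exact I_mul_mem_diamond_iff.1 (h (mem_diamondPartition_add_three.1 hz))

/-- Membership in all pieces, by inequalities which are linear in `re`, `im` and `re² + im²`. -/
theorem mem_diamondPartition_cases {z : ℂ} {i : Fin 12} (hz : z ∈ diamondPartition i) :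
    (i = 0 ∧ z.re ^ 2 + z.im ^ 2 + z.re + z.im ≤ 0 ∧ z.re ^ 2 + z.im ^ 2 + z.re - z.im ≤ 0) ∨
    (i = 1 ∧ 0 ≤ z.re ^ 2 + z.im ^ 2 + z.re + z.im ∧ 0 ≤ z.im ∧ z.im ≤ -z.re) ∨
    (i = 2 ∧ 0 ≤ z.re ^ 2 + z.im ^ 2 - z.re - z.im ∧ -z.im ≤ z.re ∧ z.re ≤ 0) ∨
    (i = 3 ∧ z.re ^ 2 + z.im ^ 2 - z.im + z.re ≤ 0 ∧ z.re ^ 2 + z.im ^ 2 - z.im - z.re ≤ 0) ∨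
    (i = 4 ∧ 0 ≤ z.re ^ 2 + z.im ^ 2 - z.im + z.re ∧ 0 ≤ z.re ∧ z.re ≤ z.im) ∨
    (i = 5 ∧ 0 ≤ z.re ^ 2 + z.im ^ 2 + z.im - z.re ∧ z.im ≤ z.re ∧ 0 ≤ z.im) ∨
    (i = 6 ∧ z.re ^ 2 + z.im ^ 2 - z.re - z.im ≤ 0 ∧ z.re ^ 2 + z.im ^ 2 - z.re + z.im ≤ 0) ∨
    (i = 7 ∧ 0 ≤ z.re ^ 2 + z.im ^ 2 - z.re - z.im ∧ z.im ≤ 0 ∧ -z.im ≤ z.re) ∨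
    (i = 8 ∧ 0 ≤ z.re ^ 2 + z.im ^ 2 + z.re + z.im ∧ z.re ≤ -z.im ∧ 0 ≤ z.re) ∨
    (i = 9 ∧ z.re ^ 2 + z.im ^ 2 + z.im - z.re ≤ 0 ∧ z.re ^ 2 + z.im ^ 2 + z.im + z.re ≤ 0) ∨
    (i = 10 ∧ 0 ≤ z.re ^ 2 + z.im ^ 2 + z.im - z.re ∧ z.re ≤ 0 ∧ z.im ≤ z.re) ∨
    (i = 11 ∧ 0 ≤ z.re ^ 2 + z.im ^ 2 - z.im + z.re ∧ z.re ≤ z.im ∧ z.im ≤ 0) := by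
  have e3 : (3 : Fin 12) = 0 + 3 := rfl
  have e4 : (4 : Fin 12) = 1 + 3 := rfl
  have e5 : (5 : Fin 12) = 2 + 3 := rfl
  have e6 : (6 : Fin 12) = 0 + 3 + 3 := rfl
  have e7 : (7 : Fin 12) = 1 + 3 + 3 := rfl
  have e8 : (8 : Fin 12) = 2 + 3 + 3 := rfl
  have e9 : (9 : Fin 12) = 0 + 3 + 3 + 3 := rfl
  have e10 : (10 : Fin 12) = 1 + 3 + 3 + 3 := rfl
  have e11 : (11 : Fin 12) = 2 + 3 + 3 + 3 := rfl
  have hi : i = 0 ∨ i = 1 ∨ i = 2 ∨ i = 3 ∨ i = 4 ∨ i = 5 ∨ i = 6 ∨ i = 7 ∨ i = 8 ∨ i = 9 ∨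
      i = 10 ∨ i = 11 := by
    clear hz
    revert i
    decide
  rcases hi with rfl | rfl | rfl | rfl | rfl | rfl | rfl | rfl | rfl | rfl | rfl | rfl
  · exact .inl ⟨rfl, (mem_diamondPartition_zero.1 hz).2⟩
  · exact .inr <| .inl ⟨rfl, (mem_diamondPartition_one.1 hz).2⟩
  · exact .inr <| .inr <| .inl ⟨rfl, (mem_diamondPartition_two.1 hz).2⟩
  · rw [e3, mem_diamondPartition_add_three, mem_diamondPartition_zero] at hz
    simp only [Complex.I_mul_re, Complex.I_mul_im] at hz
    refine .inr <| .inr <| .inr <| .inl ⟨rfl, ?_, ?_⟩ <;> linarith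
  · rw [e4, mem_diamondPartition_add_three, mem_diamondPartition_one] at hz
    simp only [Complex.I_mul_re, Complex.I_mul_im] at hz
    refine .inr <| .inr <| .inr <| .inr <| .inl ⟨rfl, ?_, ?_, ?_⟩ <;> linarith
  · rw [e5, mem_diamondPartition_add_three, mem_diamondPartition_two] at hz
    simp only [Complex.I_mul_re, Complex.I_mul_im] at hz
    refine .inr <| .inr <| .inr <| .inr <| .inr <| .inl ⟨rfl, ?_, ?_, ?_⟩ <;> linarith
  · rw [e6, mem_diamondPartition_add_three, mem_diamondPartition_add_three,
      mem_diamondPartition_zero] at hz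
    simp only [Complex.I_mul_re, Complex.I_mul_im] at hz
    refine .inr <| .inr <| .inr <| .inr <| .inr <| .inr <| .inl ⟨rfl, ?_, ?_⟩ <;> linarith
  · rw [e7, mem_diamondPartition_add_three, mem_diamondPartition_add_three,
      mem_diamondPartition_one] at hz
    simp only [Complex.I_mul_re, Complex.I_mul_im] at hz
    refine .inr <| .inr <| .inr <| .inr <| .inr <| .inr <| .inr <| .inl ⟨rfl, ?_, ?_, ?_⟩ <;>
      linarith
  · rw [e8, mem_diamondPartition_add_three, mem_diamondPartition_add_three,
      mem_diamondPartition_two] at hz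
    simp only [Complex.I_mul_re, Complex.I_mul_im] at hz
    refine .inr <| .inr <| .inr <| .inr <| .inr <| .inr <| .inr <| .inr <| .inl
      ⟨rfl, ?_, ?_, ?_⟩ <;> linarith
  · rw [e9, mem_diamondPartition_add_three, mem_diamondPartition_add_three,
      mem_diamondPartition_add_three, mem_diamondPartition_zero] at hz
    simp only [Complex.I_mul_re, Complex.I_mul_im] at hz
    refine .inr <| .inr <| .inr <| .inr <| .inr <| .inr <| .inr <| .inr <| .inr <| .inl
      ⟨rfl, ?_, ?_⟩ <;> linarith
  · rw [e10, mem_diamondPartition_add_three, mem_diamondPartition_add_three,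
      mem_diamondPartition_add_three, mem_diamondPartition_one] at hz
    simp only [Complex.I_mul_re, Complex.I_mul_im] at hz
    refine .inr <| .inr <| .inr <| .inr <| .inr <| .inr <| .inr <| .inr <| .inr <| .inr <| .inl
      ⟨rfl, ?_, ?_, ?_⟩ <;> linarith
  · rw [e11, mem_diamondPartition_add_three, mem_diamondPartition_add_three,
      mem_diamondPartition_add_three, mem_diamondPartition_two] at hz
    simp only [Complex.I_mul_re, Complex.I_mul_im] at hz
    refine .inr <| .inr <| .inr <| .inr <| .inr <| .inr <| .inr <| .inr <| .inr <| .inr <| .inr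
      ⟨rfl, ?_, ?_, ?_⟩ <;> linarith

theorem exists_mem_diamondPartition {z : ℂ} (hz : z ∈ diamond) :
    ∃ i, z ∈ diamondPartition i := by
  -- The left quarter is covered by the pieces 0, 1 and 11; the other quarters are rotated into it.
  have left : ∀ w : ℂ, w ∈ diamond → w.re + w.im ≤ 0 → w.re - w.im ≤ 0 →
      ∃ i, w ∈ diamondPartition i := by
    intro w hw h₁ h₂
    rcases le_total 0 w.im with h₃ | h₃
    · rcases le_total 0 (w.re ^ 2 + w.im ^ 2 + w.re + w.im) with h₄ | h₄
      · exact ⟨1, mem_diamondPartition_one.2 ⟨hw, h₄, h₃, by linarith⟩⟩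
      · exact ⟨0, mem_diamondPartition_zero.2 ⟨hw, h₄, by linarith⟩⟩
    · rcases le_total 0 (w.re ^ 2 + w.im ^ 2 + w.re - w.im) with h₄ | h₄
      · refine ⟨2 + 3 + 3 + 3, ?_⟩
        rw [mem_diamondPartition_add_three, mem_diamondPartition_add_three,
          mem_diamondPartition_add_three, mem_diamondPartition_two]
        simp only [I_mul_mem_diamond_iff, Complex.I_mul_re, Complex.I_mul_im]
        exact ⟨hw, by linarith, by linarith, by linarith⟩
      · exact ⟨0, mem_diamondPartition_zero.2 ⟨hw, by linarith, h₄⟩⟩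
  have rot : ∀ w : ℂ, (∃ i, Complex.I * w ∈ diamondPartition i) →
      ∃ i, w ∈ diamondPartition i :=
    fun w ⟨i, hi⟩ => ⟨i + 3, mem_diamondPartition_add_three.2 hi⟩
  rcases le_total (z.re + z.im) 0 with h₁ | h₁ <;> rcases le_total (z.re - z.im) 0 with h₂ | h₂
  · exact left z hz h₁ h₂
  · refine rot _ <| rot _ <| rot _ <| left _ ?_ ?_ ?_
    · simpa only [I_mul_mem_diamond_iff]
    · simp only [Complex.I_mul_re, Complex.I_mul_im]; linarith
    · simp only [Complex.I_mul_re, Complex.I_mul_im]; linarith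
  · refine rot _ <| left _ ?_ ?_ ?_
    · simpa only [I_mul_mem_diamond_iff]
    · simp only [Complex.I_mul_re, Complex.I_mul_im]; linarith
    · simp only [Complex.I_mul_re, Complex.I_mul_im]; linarith
  · refine rot _ <| rot _ <| left _ ?_ ?_ ?_
    · simpa only [I_mul_mem_diamond_iff]
    · simp only [Complex.I_mul_re, Complex.I_mul_im]; linarith
    · simp only [Complex.I_mul_re, Complex.I_mul_im]; linarith

theorem iUnion_diamondPartition : ⋃ i, diamondPartition i = diamond := by
  ext z
  rw [Set.mem_iUnion]
  exact ⟨fun ⟨i, hi⟩ => diamondPartition_subset_diamond i hi, exists_mem_diamondPartition⟩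

/-! ### Closedness and null boundaries -/

/-- A difference of a closed convex set and an open convex set. -/
def IsConvexDiff (S : Set ℂ) : Prop :=
  ∃ A B : Set ℂ, Convex ℝ A ∧ IsClosed A ∧ Convex ℝ B ∧ IsOpen B ∧ S = A \ B

theorem IsConvexDiff.isClosed {S : Set ℂ} (h : IsConvexDiff S) : IsClosed S := by
  obtain ⟨A, B, -, hA, -, hB, rfl⟩ := h
  exact hA.sdiff hB

/-- The frontier of A \ B lies in the union of the two frontiers, and convex sets have null
frontier. -/
theorem IsConvexDiff.volume_frontier {S : Set ℂ} (h : IsConvexDiff S) :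
    volume (frontier S) = 0 := by
  obtain ⟨A, B, hA, -, hB, -, rfl⟩ := h
  refine measure_mono_null (t := frontier A ∪ frontier B) ?_
    (measure_union_null (hA.addHaar_frontier volume) (hB.addHaar_frontier volume))
  rw [Set.sdiff_eq]
  refine (frontier_inter_subset _ _).trans ?_
  rw [frontier_compl]
  exact Set.union_subset_union Set.inter_subset_left Set.inter_subset_right

theorem convex_diamond : Convex ℝ diamond := by
  intro x hx y hy a b ha hb hab
  rw [mem_diamond_iff, abs_le, abs_le] at *
  simp only [Complex.add_re, Complex.add_im, Complex.real_smul, Complex.re_ofReal_mul,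
    Complex.im_ofReal_mul]
  obtain ⟨⟨h₁, h₂⟩, h₃, h₄⟩ := hx
  obtain ⟨⟨k₁, k₂⟩, k₃, k₄⟩ := hy
  refine ⟨⟨?_, ?_⟩, ?_, ?_⟩ <;> nlinarith

theorem isConvexDiff_diamondPartition (i : Fin 12) : IsConvexDiff (diamondPartition i) := by
  refine fin_twelve_induction (C := fun i => IsConvexDiff (diamondPartition i))
    ?_ ?_ ?_ ?_ i
  · refine ⟨diamond ∩ (Metric.closedBall ((-1 - Complex.I) / 2) (1 / √2) ∩
      Metric.closedBall ((-1 + Complex.I) / 2) (1 / √2)), ∅,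
      convex_diamond.inter ((convex_closedBall _ _).inter (convex_closedBall _ _)),
      isClosed_diamond.inter (Metric.isClosed_closedBall.inter Metric.isClosed_closedBall),
      convex_empty, isOpen_empty, ?_⟩
    ext z
    rw [Set.sdiff_empty, Set.mem_inter_iff, Set.mem_inter_iff, mem_closedBall_iff_norm,
      mem_closedBall_iff_norm]
    rfl
  · refine ⟨diamond ∩ ({z | 0 ≤ z.im} ∩ {z | z.im + z.re ≤ 0}),
      Metric.ball ((-1 - Complex.I) / 2) (1 / √2), ?_, ?_, convex_ball _ _,
      Metric.isOpen_ball, ?_⟩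
    · exact convex_diamond.inter ((convex_halfSpace_ge Complex.imLm.isLinear 0).inter
        (convex_halfSpace_le (Complex.imLm + Complex.reLm).isLinear 0))
    · exact isClosed_diamond.inter ((isClosed_le continuous_const (by fun_prop)).inter
        (isClosed_le (by fun_prop) continuous_const))
    · ext z
      simp only [Set.mem_sdiff, Set.mem_inter_iff, Set.mem_ofPred_eq, mem_ball_iff_norm, not_lt]
      change z ∈ diamond ∧ _ ∧ _ ↔ _
      rw [le_neg_iff_add_nonpos_right]
      tauto
  · refine ⟨diamond ∩ ({z | 0 ≤ z.re + z.im} ∩ {z | z.re ≤ 0}),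
      Metric.ball ((1 + Complex.I) / 2) (1 / √2), ?_, ?_, convex_ball _ _,
      Metric.isOpen_ball, ?_⟩
    · exact convex_diamond.inter
        ((convex_halfSpace_ge (Complex.reLm + Complex.imLm).isLinear 0).inter
        (convex_halfSpace_le Complex.reLm.isLinear 0))
    · exact isClosed_diamond.inter ((isClosed_le continuous_const (by fun_prop)).inter
        (isClosed_le (by fun_prop) continuous_const))
    · ext z
      simp only [Set.mem_sdiff, Set.mem_inter_iff, Set.mem_ofPred_eq, mem_ball_iff_norm, not_lt]
      change z ∈ diamond ∧ _ ∧ _ ↔ _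
      rw [neg_le_iff_add_nonneg]
      tauto
  · rintro i ⟨A, B, hA, hA', hB, hB', h⟩
    have hc : Continuous fun z : ℂ => Complex.I * z := by fun_prop
    have hl : IsLinearMap ℝ fun z : ℂ => Complex.I * z :=
      ⟨fun x y => mul_add _ _ _, fun c x => mul_smul_comm _ _ _⟩
    refine ⟨_, _, hA.is_linear_preimage hl, hA'.preimage hc, hB.is_linear_preimage hl,
      hB'.preimage hc, ?_⟩
    ext z
    rw [mem_diamondPartition_add_three, h]
    rfl

/-! ### Points off the grid -/

/-- `z` lies on none of the diagonal lines through Gaussian integers. -/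
def OffGrid (z : ℂ) : Prop := ∀ m : ℤ, z.re + z.im ≠ m ∧ z.re - z.im ≠ m

/-- The fiber is a translate of the kernel, a proper affine subspace. -/
theorem volume_fiber_eq_zero {f : ℂ →ₗ[ℝ] ℝ} (hf : f ≠ 0) (c : ℝ) :
    volume {z | f z = c} = 0 := by
  obtain ⟨v, hv⟩ : ∃ v, f v ≠ 0 := by
    by_contra! h
    exact hf (LinearMap.ext h)
  have hp : f ((c / f v) • v) = c := by
    rw [map_smul, smul_eq_mul, div_mul_cancel₀ _ hv]
  have : {z | f z = c} = (AffineSubspace.mk' ((c / f v) • v) f.ker : Set ℂ) := by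
    ext z
    rw [SetLike.mem_coe, AffineSubspace.mem_mk', vsub_eq_sub, LinearMap.mem_ker, map_sub, hp,
      sub_eq_zero]
    rfl
  rw [this]
  refine Measure.addHaar_affineSubspace _ _ fun h => ?_
  have := congrArg AffineSubspace.direction h
  rw [AffineSubspace.direction_mk', AffineSubspace.direction_top] at this
  exact hf (LinearMap.ker_eq_top.1 this)

theorem ae_offGrid : ∀ᵐ z : ℂ, OffGrid z := by
  refine ae_all_iff.2 fun m => ?_
  have h₁ : volume {z : ℂ | (Complex.reLm + Complex.imLm) z = (m : ℝ)} = 0 :=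
    volume_fiber_eq_zero (fun h => by simpa using LinearMap.congr_fun h 1) _
  have h₂ : volume {z : ℂ | (Complex.reLm - Complex.imLm) z = (m : ℝ)} = 0 :=
    volume_fiber_eq_zero (fun h => by simpa using LinearMap.congr_fun h 1) _
  filter_upwards [measure_eq_zero_iff_ae_notMem.1 h₁, measure_eq_zero_iff_ae_notMem.1 h₂]
    with z hz₁ hz₂
  exact ⟨hz₁, hz₂⟩

theorem OffGrid.of_isGaussian_sub {z w : ℂ} (hz : OffGrid z) (h : IsGaussian (w - z)) :
    OffGrid w := by
  obtain ⟨a, b, h⟩ := h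
  obtain rfl : w = z + (a + b * Complex.I) := by rw [← h]; ring
  intro m
  have h₁ := (hz (m - (a + b))).1
  have h₂ := (hz (m - (a - b))).2
  push_cast at *
  simp only [Complex.add_re, Complex.add_im, Complex.intCast_re, Complex.intCast_im,
    Complex.mul_re, Complex.mul_im, Complex.I_re, Complex.I_im]
  exact ⟨fun h => h₁ (by linarith), fun h => h₂ (by linarith)⟩

theorem not_offGrid_zero : ¬ OffGrid 0 := fun h => (h 0).1 (by simp)

theorem OffGrid.neg_I_mul {z : ℂ} (hz : OffGrid z) : OffGrid (-Complex.I * z) := by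
  intro m
  have h₁ := (hz (-m)).2
  have h₂ := (hz m).1
  push_cast at *
  simp only [neg_mul, Complex.neg_re, Complex.neg_im, Complex.I_mul_re, Complex.I_mul_im]
  exact ⟨fun h => h₁ (by linarith), fun h => h₂ (by linarith)⟩

theorem OffGrid.add_ne_zero {z : ℂ} (hz : OffGrid z) : z.re + z.im ≠ 0 := by
  simpa using (hz 0).1

theorem OffGrid.sub_ne_zero {z : ℂ} (hz : OffGrid z) : z.re - z.im ≠ 0 := by
  simpa using (hz 0).2

theorem OffGrid.unitStep {z : ℂ} (hz : OffGrid z) : OffGrid (unitStep z) := by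
  refine hz.of_isGaussian_sub ?_
  obtain ⟨m, n, h⟩ := isGaussian_sub_unitStep (w := z) (z := z) ⟨0, 0, by simp⟩
  exact ⟨-m, -n, by push_cast; linear_combination -h⟩

/-! ### Landing points -/

/-- The bounds s > -1 and d > -1 persist along the orbit: a positive coordinate drops by 1 and a
negative one rises by 1. Under them, a point outside the diamond has s > 1 or d > 1, and that
coordinate is still positive after the step. -/
theorem landing_of_one_le {z : ℂ} (hz : z ∉ diamond) (hg : OffGrid z)
    (hs : 1 ≤ z.re + z.im) (hd : 1 ≤ z.re - z.im) :
    0 < (landing z).re + (landing z).im ∨ 0 < (landing z).re - (landing z).im := by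
  have key : ∀ y, y ∉ diamond → (OffGrid y ∧ -1 < y.re + y.im ∧ -1 < y.re - y.im) →
      (OffGrid (unitStep y) ∧ -1 < (unitStep y).re + (unitStep y).im ∧
        -1 < (unitStep y).re - (unitStep y).im) ∧
      (0 < (unitStep y).re + (unitStep y).im ∨ 0 < (unitStep y).re - (unitStep y).im) := by
    rintro y hy ⟨hg, hs, hd⟩
    have hs0 := hg.add_ne_zero
    have hd0 := hg.sub_ne_zero
    have h1 : 1 < y.re + y.im ∨ 1 < y.re - y.im := by
      by_contra! h
      exact hy (mem_diamond_iff.2 ⟨abs_le.2 ⟨hs.le, h.1⟩, abs_le.2 ⟨hd.le, h.2⟩⟩)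
    refine ⟨⟨hg.unitStep, ?_⟩, ?_⟩ <;>
      rcases unitStep_cases (ne_zero_of_notMem_diamond hy) with
        ⟨i₁, i₂, e⟩ | ⟨i₁, i₂, e⟩ | ⟨i₁, i₂, e⟩ | ⟨i₁, i₂, e⟩ <;> rw [e] <;>
      simp only [Complex.sub_re, Complex.sub_im, Complex.add_re, Complex.add_im, Complex.one_re,
        Complex.one_im, Complex.I_re, Complex.I_im, sub_zero, add_zero] <;>
      grind
  exact landing_induction (Q := fun y => OffGrid y ∧ -1 < y.re + y.im ∧ -1 < y.re - y.im)
    (R := fun y => 0 < y.re + y.im ∨ 0 < y.re - y.im)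
    (fun y hy hQ _ => (key y hy hQ).1) (fun y hy hQ _ => (key y hy hQ).2) hz
    ⟨hg, by linarith, by linarith⟩

/-- The coordinate d never leaves [-1, 1], so being outside the diamond forces s > 1, and s - 1 > 0
after the step. -/
theorem landing_of_strip {z : ℂ} (hz : z ∉ diamond) (hg : OffGrid z)
    (hs : 0 ≤ z.re + z.im) (hd : -1 ≤ z.re - z.im) (hd' : z.re - z.im ≤ 1) :
    0 < (landing z).re + (landing z).im := by
  have key : ∀ y, y ∉ diamond → (OffGrid y ∧ -1 < y.re + y.im ∧ -1 ≤ y.re - y.im ∧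
        y.re - y.im ≤ 1) →
      (OffGrid (unitStep y) ∧ -1 < (unitStep y).re + (unitStep y).im ∧
        -1 ≤ (unitStep y).re - (unitStep y).im ∧ (unitStep y).re - (unitStep y).im ≤ 1) ∧
      0 < (unitStep y).re + (unitStep y).im := by
    rintro y hy ⟨hg, hs, hd, hd'⟩
    have hs0 := hg.add_ne_zero
    have hd0 := hg.sub_ne_zero
    have h1 : 1 < y.re + y.im := by
      by_contra! h
      exact hy (mem_diamond_iff.2 ⟨abs_le.2 ⟨hs.le, h⟩, abs_le.2 ⟨hd, hd'⟩⟩)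
    refine ⟨⟨hg.unitStep, ?_⟩, ?_⟩ <;>
      rcases unitStep_cases (ne_zero_of_notMem_diamond hy) with
        ⟨i₁, i₂, e⟩ | ⟨i₁, i₂, e⟩ | ⟨i₁, i₂, e⟩ | ⟨i₁, i₂, e⟩ <;> rw [e] <;>
      simp only [Complex.sub_re, Complex.sub_im, Complex.add_re, Complex.add_im, Complex.one_re,
        Complex.one_im, Complex.I_re, Complex.I_im, sub_zero, add_zero] <;>
      grind
  exact landing_induction (Q := fun y => OffGrid y ∧ -1 < y.re + y.im ∧ -1 ≤ y.re - y.im ∧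
      y.re - y.im ≤ 1) (R := fun y => 0 < y.re + y.im)
    (fun y hy hQ _ => (key y hy hQ).1) (fun y hy hQ _ => (key y hy hQ).2) hz
    ⟨hg, by linarith, by linarith, hd'⟩

theorem unitStep_add_one {z : ℂ} (hs : -1 < z.re + z.im) (hd : -1 < z.re - z.im) :
    unitStep (z + 1) = z := by
  have h0 : z + 1 ≠ 0 := by
    intro h
    have := congrArg Complex.re h
    have := congrArg Complex.im h
    simp only [Complex.add_re, Complex.add_im, Complex.one_re, Complex.one_im, Complex.zero_re,
      Complex.zero_im] at *
    linarith
  have := unitStep_cases h0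
  simp only [Complex.add_re, Complex.add_im, Complex.one_re, Complex.one_im] at this
  rcases this with ⟨i₁, i₂, e⟩ | ⟨i₁, i₂, e⟩ | ⟨i₁, i₂, e⟩ | ⟨i₁, i₂, e⟩
  · rw [e]; ring
  all_goals linarith

theorem unitStep_add_I {z : ℂ} (hs : -1 < z.re + z.im) (hd : z.re - z.im < 1) :
    unitStep (z + Complex.I) = z := by
  have h0 : z + Complex.I ≠ 0 := by
    intro h
    have := congrArg Complex.re h
    have := congrArg Complex.im h
    simp only [Complex.add_re, Complex.add_im, Complex.I_re, Complex.I_im, Complex.zero_re,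
      Complex.zero_im] at *
    linarith
  have := unitStep_cases h0
  simp only [Complex.add_re, Complex.add_im, Complex.I_re, Complex.I_im] at this
  rcases this with ⟨i₁, i₂, e⟩ | ⟨i₁, i₂, e⟩ | ⟨i₁, i₂, e⟩ | ⟨i₁, i₂, e⟩
  · linarith
  · rw [e]; ring
  all_goals linarith

theorem notMem_diamond_of_one_lt {z : ℂ} (h : 1 < z.re + z.im) : z ∉ diamond := fun hz =>
  absurd ((abs_le.1 (mem_diamond_iff.1 hz).1).2) (not_le.2 h)

theorem notMem_diamond_of_one_lt' {z : ℂ} (h : 1 < z.re - z.im) : z ∉ diamond := fun hz =>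
  absurd ((abs_le.1 (mem_diamond_iff.1 hz).2).2) (not_le.2 h)

theorem OffGrid.lt_of_mem_diamond {z : ℂ} (hg : OffGrid z) (hz : z ∈ diamond) :
    (-1 < z.re + z.im ∧ z.re + z.im < 1) ∧ -1 < z.re - z.im ∧ z.re - z.im < 1 := by
  rw [mem_diamond_iff, abs_le, abs_le] at hz
  obtain ⟨⟨h₁, h₂⟩, h₃, h₄⟩ := hz
  have g₁ := hg 1
  have g₂ := hg (-1)
  push_cast at g₁ g₂
  exact ⟨⟨h₁.lt_of_ne' g₂.1, h₂.lt_of_ne g₁.1⟩, h₃.lt_of_ne' g₂.2, h₄.lt_of_ne g₁.2⟩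

/-- This and the next four lemmas run orbits backwards: the summands are listed in the reverse order
of the steps. The sign hypotheses keep all intermediate points outside the diamond, so that `z` is
the first entry. In the mixed translates the summands 1 and i alternate because d changes sign at
every step. -/
theorem landing_add_two {z : ℂ} (hg : OffGrid z) (hz : z ∈ diamond)
    (h : 0 < z.re + z.im ∨ 0 < z.re - z.im) : landing (z + 1 + 1) = z := by
  obtain ⟨⟨h₁, h₂⟩, h₃, h₄⟩ := hg.lt_of_mem_diamond hz
  have e₁ : unitStep (z + 1) = z := unitStep_add_one h₁ h₃
  have e₂ : unitStep (z + 1 + 1) = z + 1 := by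
    apply unitStep_add_one <;> simp only [Complex.add_re, Complex.add_im, Complex.one_re,
      Complex.one_im] <;> linarith
  have hn : z + 1 ∉ diamond := by
    rcases h with h | h
    · exact notMem_diamond_of_one_lt (by simp; linarith)
    · exact notMem_diamond_of_one_lt' (by simp; linarith)
  rw [landing_of_step_notMem (by rwa [e₂]), e₂, landing_of_step_mem (by rwa [e₁]), e₁]

theorem landing_add_I_add_one {z : ℂ} (hg : OffGrid z) (hz : z ∈ diamond)
    (h : 0 < z.re + z.im) (hd : 0 < z.re - z.im) : landing (z + Complex.I + 1) = z := by
  obtain ⟨⟨h₁, h₂⟩, h₃, h₄⟩ := hg.lt_of_mem_diamond hz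
  have e₁ : unitStep (z + Complex.I) = z := unitStep_add_I h₁ h₄
  have e₂ : unitStep (z + Complex.I + 1) = z + Complex.I := by
    apply unitStep_add_one <;> simp only [Complex.add_re, Complex.add_im, Complex.I_re,
      Complex.I_im] <;> linarith
  have hn : z + Complex.I ∉ diamond := notMem_diamond_of_one_lt (by simp; linarith)
  rw [landing_of_step_notMem (by rwa [e₂]), e₂, landing_of_step_mem (by rwa [e₁]), e₁]

theorem landing_add_one_add_I {z : ℂ} (hg : OffGrid z) (hz : z ∈ diamond)
    (h : 0 < z.re + z.im) (hd : z.re - z.im < 0) : landing (z + 1 + Complex.I) = z := by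
  obtain ⟨⟨h₁, h₂⟩, h₃, h₄⟩ := hg.lt_of_mem_diamond hz
  have e₁ : unitStep (z + 1) = z := unitStep_add_one h₁ h₃
  have e₂ : unitStep (z + 1 + Complex.I) = z + 1 := by
    apply unitStep_add_I <;> simp only [Complex.add_re, Complex.add_im, Complex.one_re,
      Complex.one_im] <;> linarith
  have hn : z + 1 ∉ diamond := notMem_diamond_of_one_lt (by simp; linarith)
  rw [landing_of_step_notMem (by rwa [e₂]), e₂, landing_of_step_mem (by rwa [e₁]), e₁]

theorem landing_add_one_add_I_add_one {z : ℂ} (hg : OffGrid z) (hz : z ∈ diamond)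
    (h : 0 < z.re + z.im) (hd : z.re - z.im < 0) : landing (z + 1 + Complex.I + 1) = z := by
  obtain ⟨⟨h₁, h₂⟩, h₃, h₄⟩ := hg.lt_of_mem_diamond hz
  have e : unitStep (z + 1 + Complex.I + 1) = z + 1 + Complex.I := by
    apply unitStep_add_one <;> simp only [Complex.add_re, Complex.add_im, Complex.one_re,
      Complex.one_im, Complex.I_re, Complex.I_im] <;> linarith
  have hn : z + 1 + Complex.I ∉ diamond := notMem_diamond_of_one_lt (by simp; linarith)
  rw [landing_of_step_notMem (by rwa [e]), e, landing_add_one_add_I hg hz h hd]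

theorem landing_add_I_add_one_add_I {z : ℂ} (hg : OffGrid z) (hz : z ∈ diamond)
    (h : 0 < z.re + z.im) (hd : 0 < z.re - z.im) :
    landing (z + Complex.I + 1 + Complex.I) = z := by
  obtain ⟨⟨h₁, h₂⟩, h₃, h₄⟩ := hg.lt_of_mem_diamond hz
  have e : unitStep (z + Complex.I + 1 + Complex.I) = z + Complex.I + 1 := by
    apply unitStep_add_I <;> simp only [Complex.add_re, Complex.add_im, Complex.one_re,
      Complex.one_im, Complex.I_re, Complex.I_im] <;> linarith
  have hn : z + Complex.I + 1 ∉ diamond := notMem_diamond_of_one_lt (by simp; linarith)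
  rw [landing_of_step_notMem (by rwa [e]), e, landing_add_I_add_one hg hz h hd]

/-! ### Rotation -/

theorem unitStep_I_mul (z : ℂ) : unitStep (Complex.I * z) = Complex.I * unitStep z := by
  by_cases hz : z = 0
  · simp [hz, unitStep]
  have h := unitStep_cases (mul_ne_zero Complex.I_ne_zero hz)
  simp only [Complex.I_mul_re, Complex.I_mul_im] at h
  rcases unitStep_cases hz with ⟨i₁, i₂, e⟩ | ⟨i₁, i₂, e⟩ | ⟨i₁, i₂, e⟩ | ⟨i₁, i₂, e⟩ <;>
    rcases h with ⟨j₁, j₂, e'⟩ | ⟨j₁, j₂, e'⟩ | ⟨j₁, j₂, e'⟩ | ⟨j₁, j₂, e'⟩ <;>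
    first
      | (exfalso; linarith)
      | (rw [e, e']; ring_nf; try rw [Complex.I_sq]; ring)

theorem landing_I_mul (z : ℂ) : landing (Complex.I * z) = Complex.I * landing z := by
  have h : ∀ n, unitStep^[n] (Complex.I * z) = Complex.I * unitStep^[n] z := fun n =>
    (Function.Semiconj.iterate_right (f := fun z => Complex.I * z) (ga := unitStep)
      (gb := unitStep) (fun z => (unitStep_I_mul z).symm) n z).symm
  have : hittingNumber diamond (Complex.I * z) = hittingNumber diamond z := by
    simp only [hittingNumber, h, I_mul_mem_diamond_iff]
  rw [landing, this, h, landing]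

/-- If w = -1/(iz), then -1/z = iw, and the entry point commutes with multiplication by i. -/
theorem I_mul_gaussMap_I_mul (z : ℂ) :
    Complex.I * gaussMap diamondChoice (Complex.I * z) = gaussMap diamondChoice z := by
  by_cases hz : z = 0
  · simp [hz, gaussMap]
  rw [gaussMap, gaussMap, if_neg hz, if_neg (mul_ne_zero Complex.I_ne_zero hz)]
  obtain ⟨w, hw⟩ : ∃ w, w = -1 / (Complex.I * z) := ⟨_, rfl⟩
  have e : -1 / z = Complex.I * w := by
    rw [hw]
    field_simp [Complex.I_ne_zero]
  rw [← hw, e]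
  by_cases h : w ∈ diamond
  · rw [diamondChoice_of_mem h, diamondChoice_of_mem (I_mul_mem_diamond_iff.2 h), sub_zero,
      sub_zero]
  · rw [sub_diamondChoice h, sub_diamondChoice (by rwa [I_mul_mem_diamond_iff]), landing_I_mul]

/-! ### The pieces in the coordinate `w = -1 / z` -/

/-- Here i is the real number 1/|w|². It is also |-1/w|², so it factors out of the circle
inequalities and leaves linear conditions on w. -/
theorem neg_one_div_coords {w : ℂ} (hw : w ≠ 0) : ∃ i : ℝ, 0 < i ∧
    i * (w.re ^ 2 + w.im ^ 2) = 1 ∧ (-1 / w).re = -(i * w.re) ∧ (-1 / w).im = i * w.im ∧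
    (-1 / w).re ^ 2 + (-1 / w).im ^ 2 = i := by
  have h : 0 < w.re ^ 2 + w.im ^ 2 := by
    have := Complex.normSq_pos.2 hw
    rw [Complex.normSq_apply] at this
    nlinarith
  have h₁ : (-1 / w).re = -((w.re ^ 2 + w.im ^ 2)⁻¹ * w.re) := by
    rw [neg_div, one_div, Complex.neg_re, Complex.inv_re, Complex.normSq_apply, ← sq, ← sq,
      div_eq_inv_mul]
  have h₂ : (-1 / w).im = (w.re ^ 2 + w.im ^ 2)⁻¹ * w.im := by
    rw [neg_div, one_div, Complex.neg_im, Complex.inv_im, Complex.normSq_apply, ← sq, ← sq,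
      div_eq_inv_mul, mul_neg, neg_neg]
  refine ⟨(w.re ^ 2 + w.im ^ 2)⁻¹, by positivity, inv_mul_cancel₀ h.ne', h₁, h₂, ?_⟩
  rw [h₁, h₂]
  field_simp

theorem neg_one_div_mem_diamond_iff {w : ℂ} (hw : w ≠ 0) :
    -1 / w ∈ diamond ↔ |w.re| + |w.im| ≤ w.re ^ 2 + w.im ^ 2 := by
  obtain ⟨i, hi, h1, hre, him, hsq⟩ := neg_one_div_coords hw
  simp only [diamond, Set.mem_ofPred_eq]
  rw [hre, him, abs_neg, abs_mul, abs_mul, abs_of_pos hi, ← h1, ← mul_add,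
    mul_le_mul_iff_right₀ hi]

theorem neg_one_div_mem_diamondPartition_zero_iff {w : ℂ} (hw : w ≠ 0) :
    -1 / w ∈ diamondPartition 0 ↔ |w.re| + |w.im| ≤ w.re ^ 2 + w.im ^ 2 ∧
      1 ≤ w.re - w.im ∧ 1 ≤ w.re + w.im := by
  rw [mem_diamondPartition_zero, neg_one_div_mem_diamond_iff hw]
  obtain ⟨i, hi, h1, hre, him, hsq⟩ := neg_one_div_coords hw
  rw [hsq, hre, him, ← sub_nonneg (b := (1 : ℝ)), ← sub_nonneg (b := (1 : ℝ)),
    ← mul_nonneg_iff_of_pos_left hi (b := w.re - w.im - 1),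
    ← mul_nonneg_iff_of_pos_left hi (b := w.re + w.im - 1)]
  refine and_congr_right fun _ => and_congr ?_ ?_ <;> constructor <;> intro h <;> linarith

theorem neg_one_div_mem_diamondPartition_one_iff {w : ℂ} (hw : w ≠ 0) :
    -1 / w ∈ diamondPartition 1 ↔ |w.re| + |w.im| ≤ w.re ^ 2 + w.im ^ 2 ∧
      w.re - w.im ≤ 1 ∧ 0 ≤ w.im ∧ w.im ≤ w.re := by
  rw [mem_diamondPartition_one, neg_one_div_mem_diamond_iff hw]
  obtain ⟨i, hi, h1, hre, him, hsq⟩ := neg_one_div_coords hw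
  rw [hsq, hre, him, ← sub_nonneg (b := w.re - w.im),
    ← mul_nonneg_iff_of_pos_left hi (b := 1 - (w.re - w.im)), mul_nonneg_iff_of_pos_left hi,
    neg_neg, mul_le_mul_iff_right₀ hi]
  refine and_congr_right fun _ => and_congr ?_ Iff.rfl
  constructor <;> intro h <;> linarith

theorem neg_one_div_mem_diamondPartition_two_iff {w : ℂ} (hw : w ≠ 0) :
    -1 / w ∈ diamondPartition 2 ↔ |w.re| + |w.im| ≤ w.re ^ 2 + w.im ^ 2 ∧
      w.im - w.re ≤ 1 ∧ w.re ≤ w.im ∧ 0 ≤ w.re := by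
  rw [mem_diamondPartition_two, neg_one_div_mem_diamond_iff hw]
  obtain ⟨i, hi, h1, hre, him, hsq⟩ := neg_one_div_coords hw
  rw [hsq, hre, him, ← sub_nonneg (b := w.im - w.re),
    ← mul_nonneg_iff_of_pos_left hi (b := 1 - (w.im - w.re)), neg_le_neg_iff,
    mul_le_mul_iff_right₀ hi, neg_nonpos, mul_nonneg_iff_of_pos_left hi]
  refine and_congr_right fun _ => and_congr ?_ Iff.rfl
  constructor <;> intro h <;> linarith

/-! ### Images of the pieces under the Gauss map -/

theorem gaussMap_neg_one_div {w : ℂ} (hw : w ∉ diamond) :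
    gaussMap diamondChoice (-1 / w) = landing w := by
  have h0 := ne_zero_of_notMem_diamond hw
  have e : -1 / (-1 / w) = w := by field_simp
  rw [gaussMap, if_neg (div_ne_zero (by norm_num) h0), e, sub_diamondChoice hw]

/-- A point off the grid in the image of `S` is the landing point of some `w` with
`-1 / w ∈ S`. -/
theorem exists_landing_eq_of_mem_image {S : Set ℂ} (hS : S ⊆ diamond) {p : ℂ} (hp : OffGrid p)
    (h : p ∈ gaussMap diamondChoice '' S) :
    ∃ w, w ∉ diamond ∧ OffGrid w ∧ w ≠ 0 ∧ -1 / w ∈ S ∧ landing w = p := by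
  obtain ⟨z, hz, rfl⟩ := h
  have hz0 : z ≠ 0 := by
    rintro rfl
    exact not_offGrid_zero (by simpa [gaussMap] using hp)
  have e : -1 / (-1 / z) = z := by field_simp
  have hg : gaussMap diamondChoice z = -1 / z - diamondChoice (-1 / z) := by
    rw [gaussMap, if_neg hz0]
  rw [hg] at hp
  have hgrid : OffGrid (-1 / z) := hp.of_isGaussian_sub <| by
    rw [sub_sub_cancel]
    exact isGaussian_diamondChoice _
  -- If z and -1/z were both in the diamond, both would have norm 1. But s² + d² = 2|-1/z|², and off
  -- the grid |s|, |d| < 1.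
  have hw : -1 / z ∉ diamond := by
    intro hmem
    have hn : ‖-1 / z‖ = 1 := by
      refine le_antisymm (norm_le_one_of_mem_diamond hmem) ?_
      rw [norm_div, norm_neg, norm_one, one_le_div (norm_pos_iff.2 hz0)]
      exact norm_le_one_of_mem_diamond (hS hz)
    obtain ⟨⟨h₁, h₂⟩, h₃, h₄⟩ := hgrid.lt_of_mem_diamond hmem
    have := Complex.sq_norm (-1 / z)
    rw [hn, Complex.normSq_apply] at this
    nlinarith [mul_pos (sub_pos.2 h₁) (sub_pos.2 h₂), mul_pos (sub_pos.2 h₃) (sub_pos.2 h₄)]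
  refine ⟨-1 / z, hw, hgrid, ne_zero_of_notMem_diamond hw, by rwa [e], ?_⟩
  rw [hg, sub_diamondChoice hw]

theorem mem_image_gaussMap {S : Set ℂ} {w p : ℂ} (hw : w ∉ diamond) (hS : -1 / w ∈ S)
    (h : landing w = p) : p ∈ gaussMap diamondChoice '' S :=
  ⟨_, hS, by rw [gaussMap_neg_one_div hw, h]⟩

theorem mem_image_diamondPartition_zero_iff {p : ℂ} (hp : OffGrid p) :
    p ∈ gaussMap diamondChoice '' diamondPartition 0 ↔
      p ∈ diamond ∧ (0 < p.re + p.im ∨ 0 < p.re - p.im) := by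
  constructor
  · intro h
    obtain ⟨w, hw, hg, h0, hS, rfl⟩ :=
      exists_landing_eq_of_mem_image (diamondPartition_subset_diamond 0) hp h
    rw [neg_one_div_mem_diamondPartition_zero_iff h0] at hS
    exact ⟨landing_mem_diamond hw, landing_of_one_le hw hg hS.2.2 hS.2.1⟩
  · rintro ⟨hX, h⟩
    obtain ⟨⟨h₁, h₂⟩, h₃, h₄⟩ := hp.lt_of_mem_diamond hX
    have hw : p + 1 + 1 ∉ diamond := by
      rcases h with h | h
      · exact notMem_diamond_of_one_lt (by simp; linarith)
      · exact notMem_diamond_of_one_lt' (by simp; linarith)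
    refine mem_image_gaussMap hw ?_ (landing_add_two hp hX h)
    rw [neg_one_div_mem_diamondPartition_zero_iff (ne_zero_of_notMem_diamond hw)]
    simp only [Complex.add_re, Complex.add_im, Complex.one_re, Complex.one_im, add_zero]
    refine ⟨?_, by linarith, by linarith⟩
    cases abs_cases (p.re + 1 + 1) <;> cases abs_cases p.im <;> nlinarith

/-- From x² + y² ≥ (x + y)²/2 ≥ x + y. It places -1/w in the diamond for the translates w used
below. -/
theorem abs_add_abs_le_sq_add_sq {x y : ℝ} (hx : 0 ≤ x) (hy : 0 ≤ y) (h : 2 ≤ x + y) :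
    |x| + |y| ≤ x ^ 2 + y ^ 2 := by
  rw [abs_of_nonneg hx, abs_of_nonneg hy]
  nlinarith [sq_nonneg (x - y)]

theorem mem_image_diamondPartition_one_iff {p : ℂ} (hp : OffGrid p) :
    p ∈ gaussMap diamondChoice '' diamondPartition 1 ↔ p ∈ diamond ∧ 0 < p.re + p.im := by
  constructor
  · intro h
    obtain ⟨w, hw, hg, h0, hS, rfl⟩ :=
      exists_landing_eq_of_mem_image (diamondPartition_subset_diamond 1) hp h
    rw [neg_one_div_mem_diamondPartition_one_iff h0] at hS
    exact ⟨landing_mem_diamond hw, landing_of_strip hw hg (by linarith) (by linarith) hS.2.1⟩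
  · rintro ⟨hX, h⟩
    obtain ⟨⟨h₁, h₂⟩, h₃, h₄⟩ := hp.lt_of_mem_diamond hX
    -- The preimage must satisfy 0 ≤ d ≤ 1: the translate by 2 + i raises a negative d by 1, while 1
    -- + i keeps a positive d.
    rcases hp.sub_ne_zero.lt_or_gt with hd | hd
    · have hw : p + 1 + Complex.I + 1 ∉ diamond := notMem_diamond_of_one_lt (by simp; linarith)
      refine mem_image_gaussMap hw ?_ (landing_add_one_add_I_add_one hp hX h hd)
      rw [neg_one_div_mem_diamondPartition_one_iff (ne_zero_of_notMem_diamond hw)]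
      simp only [Complex.add_re, Complex.add_im, Complex.one_re, Complex.one_im, Complex.I_re,
        Complex.I_im, add_zero]
      refine ⟨abs_add_abs_le_sq_add_sq ?_ ?_ ?_, ?_, ?_, ?_⟩ <;> linarith
    · have hw : p + Complex.I + 1 ∉ diamond := notMem_diamond_of_one_lt (by simp; linarith)
      refine mem_image_gaussMap hw ?_ (landing_add_I_add_one hp hX h hd)
      rw [neg_one_div_mem_diamondPartition_one_iff (ne_zero_of_notMem_diamond hw)]
      simp only [Complex.add_re, Complex.add_im, Complex.one_re, Complex.one_im, Complex.I_re,
        Complex.I_im, add_zero]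
      refine ⟨abs_add_abs_le_sq_add_sq ?_ ?_ ?_, ?_, ?_, ?_⟩ <;> linarith

theorem mem_image_diamondPartition_two_iff {p : ℂ} (hp : OffGrid p) :
    p ∈ gaussMap diamondChoice '' diamondPartition 2 ↔ p ∈ diamond ∧ 0 < p.re + p.im := by
  constructor
  · intro h
    obtain ⟨w, hw, hg, h0, hS, rfl⟩ :=
      exists_landing_eq_of_mem_image (diamondPartition_subset_diamond 2) hp h
    rw [neg_one_div_mem_diamondPartition_two_iff h0] at hS
    exact ⟨landing_mem_diamond hw,
      landing_of_strip hw hg (by linarith) (by linarith) (by linarith)⟩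
  · rintro ⟨hX, h⟩
    obtain ⟨⟨h₁, h₂⟩, h₃, h₄⟩ := hp.lt_of_mem_diamond hX
    -- Now -1 ≤ d ≤ 0 is needed: 1 + i keeps a negative d, and 1 + 2i lowers a positive d by 1.
    rcases hp.sub_ne_zero.lt_or_gt with hd | hd
    · have hw : p + 1 + Complex.I ∉ diamond := notMem_diamond_of_one_lt (by simp; linarith)
      refine mem_image_gaussMap hw ?_ (landing_add_one_add_I hp hX h hd)
      rw [neg_one_div_mem_diamondPartition_two_iff (ne_zero_of_notMem_diamond hw)]
      simp only [Complex.add_re, Complex.add_im, Complex.one_re, Complex.one_im, Complex.I_re,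
        Complex.I_im, add_zero]
      refine ⟨abs_add_abs_le_sq_add_sq ?_ ?_ ?_, ?_, ?_, ?_⟩ <;> linarith
    · have hw : p + Complex.I + 1 + Complex.I ∉ diamond :=
        notMem_diamond_of_one_lt (by simp; linarith)
      refine mem_image_gaussMap hw ?_ (landing_add_I_add_one_add_I hp hX h hd)
      rw [neg_one_div_mem_diamondPartition_two_iff (ne_zero_of_notMem_diamond hw)]
      simp only [Complex.add_re, Complex.add_im, Complex.one_re, Complex.one_im, Complex.I_re,
        Complex.I_im, add_zero]
      refine ⟨abs_add_abs_le_sq_add_sq ?_ ?_ ?_, ?_, ?_, ?_⟩ <;> linarith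

/-! ### The finite building property -/

/-- The image of the piece `i` is a union of pieces, up to points on the grid. -/
def IsBuildableOffGrid (i : Fin 12) : Prop :=
  ∃ J : Set (Fin 12), ∀ p, OffGrid p →
    (p ∈ gaussMap diamondChoice '' diamondPartition i ↔ ∃ j ∈ J, p ∈ diamondPartition j)

theorem IsBuildableOffGrid.add_three {i : Fin 12} (h : IsBuildableOffGrid i) :
    IsBuildableOffGrid (i + 3) := by
  obtain ⟨J, hJ⟩ := h
  have hI : ∀ q : ℂ, Complex.I * (-Complex.I * q) = q := fun q => by
    linear_combination -q * Complex.I_sq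
  have hI' : ∀ q : ℂ, -Complex.I * (Complex.I * q) = q := fun q => by
    linear_combination -q * Complex.I_sq
  -- The image of piece i + 3 is i times that of piece i, and multiplication by the imaginary unit
  -- takes piece j + 3 to piece j.
  refine ⟨{j | j + 3 ∈ J}, fun p hp => ?_⟩
  have h₁ : p ∈ gaussMap diamondChoice '' diamondPartition (i + 3) ↔
      -Complex.I * p ∈ gaussMap diamondChoice '' diamondPartition i := by
    constructor
    · rintro ⟨z, hz, rfl⟩
      refine ⟨_, mem_diamondPartition_add_three.1 hz, ?_⟩
      rw [← I_mul_gaussMap_I_mul z, hI']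
    · rintro ⟨y, hy, e⟩
      refine ⟨-Complex.I * y, mem_diamondPartition_add_three.2 (by rwa [hI]), ?_⟩
      rw [← I_mul_gaussMap_I_mul, hI, e, hI]
  rw [h₁, hJ _ hp.neg_I_mul]
  constructor
  · rintro ⟨j, hj, h⟩
    obtain ⟨k, rfl⟩ : ∃ k, j = k + 3 := ⟨j - 3, (sub_add_cancel j 3).symm⟩
    rw [mem_diamondPartition_add_three, hI] at h
    exact ⟨k, hj, h⟩
  · rintro ⟨k, hk, h⟩
    exact ⟨k + 3, hk, by rwa [mem_diamondPartition_add_three, hI]⟩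

theorem exists_mem_ne_left_iff {p : ℂ} (hp : OffGrid p) :
    (∃ j ∈ ({0, 1, 11} : Set (Fin 12))ᶜ, p ∈ diamondPartition j) ↔
      p ∈ diamond ∧ (0 < p.re + p.im ∨ 0 < p.re - p.im) := by
  have hs := hp.add_ne_zero
  have hd := hp.sub_ne_zero
  have q₁ := sq_nonneg p.re
  have q₂ := sq_nonneg p.im
  constructor
  · rintro ⟨j, hj, hpj⟩
    refine ⟨diamondPartition_subset_diamond j hpj, ?_⟩
    by_contra! hn
    obtain ⟨n₁, n₂⟩ := hn
    have n₁ := n₁.lt_of_ne hs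
    have n₂ := n₂.lt_of_ne hd
    rcases mem_diamondPartition_cases hpj with ⟨rfl, h⟩ | ⟨rfl, h⟩ | ⟨rfl, h⟩ | ⟨rfl, h⟩ |
      ⟨rfl, h⟩ | ⟨rfl, h⟩ | ⟨rfl, h⟩ | ⟨rfl, h⟩ | ⟨rfl, h⟩ | ⟨rfl, h⟩ | ⟨rfl, h⟩ | ⟨rfl, h⟩ <;>
    first
      | (exfalso; linarith)
      | exact hj (by simp)
  · rintro ⟨hX, h⟩
    obtain ⟨j, hj⟩ := exists_mem_diamondPartition hX
    refine ⟨j, ?_, hj⟩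
    rintro (rfl | rfl | rfl) <;> have hc := mem_diamondPartition_cases hj <;>
      norm_num [Fin.ext_iff] at hc <;> rcases h with h | h <;> linarith

theorem exists_mem_upper_iff {p : ℂ} (hp : OffGrid p) :
    (∃ j ∈ ({2, 3, 4, 5, 6, 7} : Set (Fin 12)), p ∈ diamondPartition j) ↔
      p ∈ diamond ∧ 0 < p.re + p.im := by
  have hs := hp.add_ne_zero
  have q₁ := sq_nonneg p.re
  have q₂ := sq_nonneg p.im
  constructor
  · rintro ⟨j, hj, hpj⟩
    refine ⟨diamondPartition_subset_diamond j hpj, ?_⟩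
    by_contra! n
    have n := n.lt_of_ne hs
    rcases hj with rfl | rfl | rfl | rfl | rfl | rfl <;>
      have hc := mem_diamondPartition_cases hpj <;>
      norm_num [Fin.ext_iff] at hc <;> linarith
  · rintro ⟨hX, h⟩
    obtain ⟨j, hj⟩ := exists_mem_diamondPartition hX
    refine ⟨j, ?_, hj⟩
    rcases mem_diamondPartition_cases hj with ⟨rfl, h⟩ | ⟨rfl, h⟩ | ⟨rfl, h⟩ | ⟨rfl, h⟩ |
      ⟨rfl, h⟩ | ⟨rfl, h⟩ | ⟨rfl, h⟩ | ⟨rfl, h⟩ | ⟨rfl, h⟩ | ⟨rfl, h⟩ | ⟨rfl, h⟩ | ⟨rfl, h⟩ <;>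
    first
      | (simp; done)
      | linarith

theorem isBuildableOffGrid (i : Fin 12) : IsBuildableOffGrid i :=
  fin_twelve_induction
    ⟨_, fun _ hp => (mem_image_diamondPartition_zero_iff hp).trans
      (exists_mem_ne_left_iff hp).symm⟩
    ⟨_, fun _ hp => (mem_image_diamondPartition_one_iff hp).trans
      (exists_mem_upper_iff hp).symm⟩
    ⟨_, fun _ hp => (mem_image_diamondPartition_two_iff hp).trans
      (exists_mem_upper_iff hp).symm⟩
    (fun _ h => h.add_three) i

theorem isBuildable_image (i : Fin 12) :
    IsBuildable diamondPartition (gaussMap diamondChoice '' diamondPartition i) := by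
  obtain ⟨J, hJ⟩ := isBuildableOffGrid i
  refine ⟨J, Filter.eventuallyEq_set.2 ?_⟩
  filter_upwards [ae_offGrid] with p hp
  rw [hJ p hp]
  simp

/-! ### Interiors -/

theorem nonempty_interior_diamondPartition (i : Fin 12) :
    (interior (diamondPartition i)).Nonempty := by
  refine fin_twelve_induction (C := fun i => (interior (diamondPartition i)).Nonempty)
    ?_ ?_ ?_ ?_ i
  · let U : Set ℂ := {z | |z.re| + |z.im| < 1} ∩ ({z | z.re ^ 2 + z.im ^ 2 + z.re + z.im < 0} ∩
      {z | z.re ^ 2 + z.im ^ 2 + z.re - z.im < 0})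
    have hU : IsOpen U := by
      refine (isOpen_lt ?_ ?_).inter ((isOpen_lt ?_ ?_).inter (isOpen_lt ?_ ?_)) <;> fun_prop
    refine ⟨⟨-1 / 2, 0⟩, interior_maximal (fun z hz => ?_) hU ?_⟩
    · exact mem_diamondPartition_zero.2 ⟨le_of_lt (show |z.re| + |z.im| < 1 from hz.1), hz.2.1.le, hz.2.2.le⟩
    · change _ ∧ _ ∧ _
      norm_num [abs_of_neg]
  · let U : Set ℂ := {z | |z.re| + |z.im| < 1} ∩ ({z | 0 < z.re ^ 2 + z.im ^ 2 + z.re + z.im} ∩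
      ({z | 0 < z.im} ∩ {z | z.im < -z.re}))
    have hU : IsOpen U := by
      refine (isOpen_lt ?_ ?_).inter
        ((isOpen_lt ?_ ?_).inter ((isOpen_lt ?_ ?_).inter (isOpen_lt ?_ ?_))) <;> fun_prop
    refine ⟨⟨-1 / 2, 2 / 5⟩, interior_maximal (fun z hz => ?_) hU ?_⟩
    · exact mem_diamondPartition_one.2 ⟨le_of_lt (show |z.re| + |z.im| < 1 from hz.1), hz.2.1.le, hz.2.2.1.le, hz.2.2.2.le⟩
    · change _ ∧ _ ∧ _ ∧ _
      norm_num [abs_of_neg, abs_of_pos]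
  · let U : Set ℂ := {z | |z.re| + |z.im| < 1} ∩ ({z | 0 < z.re ^ 2 + z.im ^ 2 - z.re - z.im} ∩
      ({z | -z.im < z.re} ∩ {z | z.re < 0}))
    have hU : IsOpen U := by
      refine (isOpen_lt ?_ ?_).inter
        ((isOpen_lt ?_ ?_).inter ((isOpen_lt ?_ ?_).inter (isOpen_lt ?_ ?_))) <;> fun_prop
    refine ⟨⟨-2 / 5, 1 / 2⟩, interior_maximal (fun z hz => ?_) hU ?_⟩
    · exact mem_diamondPartition_two.2 ⟨le_of_lt (show |z.re| + |z.im| < 1 from hz.1), hz.2.1.le, hz.2.2.1.le, hz.2.2.2.le⟩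
    · change _ ∧ _ ∧ _ ∧ _
      norm_num [abs_of_neg, abs_of_pos]
  · rintro i ⟨z, hz⟩
    have hc : Continuous fun z : ℂ => Complex.I * z := by fun_prop
    refine ⟨-Complex.I * z, interior_maximal (s := diamondPartition (i + 3))
      (t := (fun z => Complex.I * z) ⁻¹' interior (diamondPartition i)) (fun y hy => ?_)
      (isOpen_interior.preimage hc) ?_⟩
    · exact mem_diamondPartition_add_three.2 (interior_subset hy)
    · rw [Set.mem_preimage, ← mul_assoc, mul_neg, Complex.I_mul_I, neg_neg, one_mul]
      exact hz

theorem ae_sq_add_sq_ne {a b : ℝ} (ha : a ^ 2 = 1) (hb : b ^ 2 = 1) :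
    ∀ᵐ z : ℂ, z.re ^ 2 + z.im ^ 2 - a * z.re - b * z.im ≠ 0 := by
  filter_upwards [measure_eq_zero_iff_ae_notMem.1
    (Measure.addHaar_sphere volume (((a : ℂ) + b * Complex.I) / 2) (1 / √2))] with z hz h
  exact hz (mem_sphere_iff_norm.2 (le_antisymm
    ((norm_sub_le_inv_sqrt_two_iff ha hb rfl).2 h.le)
    ((inv_sqrt_two_le_norm_sub_iff ha hb rfl).2 h.ge)))

/-- Points common to two distinct pieces lie on one of eight null curves: the axes, the two
diagonals through 0 and the four circles. -/
theorem ae_eq_of_mem_diamondPartition :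
    ∀ᵐ z : ℂ, ∀ i j, z ∈ diamondPartition i → z ∈ diamondPartition j → i = j := by
  have h₁ : volume {z : ℂ | Complex.reLm z = 0} = 0 :=
    volume_fiber_eq_zero (fun h => by simpa using LinearMap.congr_fun h 1) _
  have h₂ : volume {z : ℂ | Complex.imLm z = 0} = 0 :=
    volume_fiber_eq_zero (fun h => by simpa using LinearMap.congr_fun h Complex.I) _
  have c₁ := ae_sq_add_sq_ne (a := 1) (b := 1) (by norm_num) (by norm_num)
  have c₂ := ae_sq_add_sq_ne (a := 1) (b := -1) (by norm_num) (by norm_num)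
  have c₃ := ae_sq_add_sq_ne (a := -1) (b := 1) (by norm_num) (by norm_num)
  have c₄ := ae_sq_add_sq_ne (a := -1) (b := -1) (by norm_num) (by norm_num)
  filter_upwards [measure_eq_zero_iff_ae_notMem.1 h₁, measure_eq_zero_iff_ae_notMem.1 h₂,
    ae_offGrid, c₁, c₂, c₃, c₄] with z hre him hg k₁ k₂ k₃ k₄ i j hi hj
  replace hre : z.re ≠ 0 := hre
  replace him : z.im ≠ 0 := him
  have hs := hg.add_ne_zero
  have hd := hg.sub_ne_zero
  have hq : 0 ≤ z.re ^ 2 + z.im ^ 2 := by positivity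
  have ci := mem_diamondPartition_cases hi
  have cj := mem_diamondPartition_cases hj
  clear hi hj hg
  -- With q as an independent variable, every condition is linear in q, u and v.
  generalize z.re ^ 2 + z.im ^ 2 = q at *
  generalize z.re = u at *
  generalize z.im = v at *
  rcases ci with ⟨rfl, hi⟩ | ⟨rfl, hi⟩ | ⟨rfl, hi⟩ | ⟨rfl, hi⟩ | ⟨rfl, hi⟩ | ⟨rfl, hi⟩ |
      ⟨rfl, hi⟩ | ⟨rfl, hi⟩ | ⟨rfl, hi⟩ | ⟨rfl, hi⟩ | ⟨rfl, hi⟩ | ⟨rfl, hi⟩ <;>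
    rcases cj with ⟨rfl, hj⟩ | ⟨rfl, hj⟩ | ⟨rfl, hj⟩ | ⟨rfl, hj⟩ | ⟨rfl, hj⟩ | ⟨rfl, hj⟩ |
      ⟨rfl, hj⟩ | ⟨rfl, hj⟩ | ⟨rfl, hj⟩ | ⟨rfl, hj⟩ | ⟨rfl, hj⟩ | ⟨rfl, hj⟩ <;>
    first
      | rfl
      | exact absurd (by linarith) hs
      | exact absurd (by linarith) hd
      | exact absurd (by linarith) hre
      | exact absurd (by linarith) him
      | exact absurd (by linarith) k₁
      | exact absurd (by linarith) k₂
      | exact absurd (by linarith) k₃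
      | exact absurd (by linarith) k₄

theorem disjoint_interior_diamondPartition {i j : Fin 12} (hij : i ≠ j) :
    Disjoint (interior (diamondPartition i)) (interior (diamondPartition j)) := by
  rw [Set.disjoint_iff_inter_eq_empty]
  -- An open null set is empty, so almost everywhere uniqueness of the piece is enough.
  refine (isOpen_interior.inter isOpen_interior).eq_empty_of_measure_zero (μ := volume) ?_
  rw [measure_eq_zero_iff_ae_notMem]
  filter_upwards [ae_eq_of_mem_diamondPartition] with z hz h
  exact hij (hz i j (interior_subset h.1) (interior_subset h.2))

theorem isInteriorPartition_diamondPartition : IsInteriorPartition diamondPartition diamond where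
  nonempty i := (nonempty_interior_diamondPartition i).mono interior_subset
  injective i j h := by
    by_contra hij
    have := disjoint_interior_diamondPartition hij
    rw [h, disjoint_self] at this
    exact (nonempty_interior_diamondPartition j).ne_empty this
  iUnion_eq := iUnion_diamondPartition
  disjoint_interior _ _ := disjoint_interior_diamondPartition

theorem mainTheorem10 :
    (∀ z : ℂ, z ∉ diamond → ∃ n : ℕ, 1 ≤ n ∧ unitStep^[n] z ∈ diamond) ∧
    IsChoiceFunction diamondChoice ∧
    fundamentalSet diamondChoice = diamond ∧
    SatisfiesFiniteBuildingWith diamondChoice diamondPartition := by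
  refine ⟨fun _ => exists_iterate_unitStep_mem_diamond, isChoiceFunction_diamondChoice,
    fundamentalSet_diamondChoice, ?_⟩
  exact
    { one_lt := by norm_num
      partition := by
        rw [fundamentalSet_diamondChoice]
        exact isInteriorPartition_diamondPartition
      isClosed := fun i => (isConvexDiff_diamondPartition i).isClosed
      volume_frontier := fun i => (isConvexDiff_diamondPartition i).volume_frontier
      buildable := isBuildable_image }
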